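/- Let $w=(w_n)_{n\in\mathbb Z}$ be a sequence of positive real numbers, and let $X$ be the complex Banach space $\ell_p(\mathbb Z)$ with $1\le p<\infty$, or $c_0(\mathbb Z)$ with the supremum norm. Suppose that the bilateral weighted shift $B_w(x_n)_{n\in\mathbb Z}=(w_{n+1}x_{n+1})_{n\in\mathbb Z}$ defines an invertible bounded linear operator on $X$. Then $B_w$ is strongly structurally stable if and only if $B_w$ has the shadowing property. Here a bounded linear operator $T$ on a complex Banach space $X$ is strongly structurally stable if for every $\varepsilon>0$ there is $\delta>0$ such that, for every Lipschitz map $\alpha:X\to X$ with $\sup_{x}\|\alpha(x)\|\le\delta$ and Lipschitz constant at most $\delta$, there is a map $\varphi:X\to X$ with $\sup_x\|\varphi(x)\|\le\varepsilon$ such that $I+\varphi$ is a homeomorphism of $X$ onto $X$ and $T\circ(I+\varphi)=(I+\varphi)\circ(T+\alpha)$. An invertible bounded linear operator $T$ on $X$ has the shadowing property if for every $\varepsilon>0$ there is $\delta>0$ such that, for every sequence $(x_n)_{n\in\mathbb Z}$ in $X$ with $\|Tx_n-x_{n+1}\|\le\delta$ for all $n\in\mathbb Z$, there is $x\in X$ with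 $\|T^nx-x_n\|<\varepsilon$ for all $n\in\mathbb Z$. -/

import Mathlib

/-!
A diagonal change of coordinates turns `B_w` into the unweighted backward shift on a space in which
the coordinate functionals have norms `v k`. Both shadowing and stability, applied to perturbations
that push a constant amount along the unit vectors, force a discrete primitive `s` of `-v` to
satisfy `|s| ≤ K v`. Then `s` decays geometrically to the right wherever it is nonnegative and `-s`
decays geometrically to the left wherever it is nonnegative, so separating the coordinates
according to the sign of `s k + s (k + 1)` gives a projection `P` such that `T ^ m ∘ P` and
`T ^ (-m) ∘ (1 - P)` decay geometrically.

These operators form a summable kernel, and convolution with it solves `y_{n+1} = T y_n + c_n` in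
bounded sequences. This corrects a pseudotrajectory to an orbit. For a Lipschitz perturbation `S` of
`T`, the equation for a conjugacy `1 + φ` becomes a fixed point equation for a contraction, and the
conjugacies from `S` to `T` and from `T` to `S` are inverse to each other because fixed points are
unique.
-/

open scoped ENNReal

/-- The formal bilateral weighted backward shift `B_w (x_n) = (w_{n+1} x_{n+1})` on all complex
sequences indexed by `ℤ`. -/
def bilateralShift (w : ℤ → ℝ) (x : ℤ → ℂ) : ℤ → ℂ :=
  fun n => (w (n + 1) : ℂ) * x (n + 1)

section Dynamics

variable {X : Type*} [NormedAddCommGroup X] [NormedSpace ℂ X]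

/-- Strong structural stability: every perturbation `T + α` of `T`, with `α` Lipschitz, uniformly
small and of small Lipschitz constant, is conjugate to `T` by a homeomorphism `I + φ` of `X` that
is uniformly close to the identity. -/
def StronglyStructurallyStable (T : X →L[ℂ] X) : Prop :=
  ∀ ε : ℝ, 0 < ε → ∃ δ : ℝ, 0 < δ ∧
    ∀ α : X → X, (∀ x, ‖α x‖ ≤ δ) → (∀ x y, ‖α x - α y‖ ≤ δ * ‖x - y‖) →
      ∃ φ : X → X, (∀ x, ‖φ x‖ ≤ ε) ∧ IsHomeomorph (fun x => x + φ x) ∧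
        ∀ x, T (x + φ x) = (T x + α x) + φ (T x + α x)

/-- `(x_n)_{n ∈ ℤ}` is a `δ`-pseudotrajectory of `T`. -/
def IsPseudotrajectory (T : X →L[ℂ] X) (δ : ℝ) (x : ℤ → X) : Prop :=
  ∀ n : ℤ, ‖T (x n) - x (n + 1)‖ ≤ δ

/-- The shadowing property of an invertible operator; `T ^ n`, `n ∈ ℤ`, is the power in the group
of invertible bounded operators. -/
def HasShadowing (T : X ≃L[ℂ] X) : Prop :=
  ∀ ε : ℝ, 0 < ε → ∃ δ : ℝ, 0 < δ ∧
    ∀ x : ℤ → X, IsPseudotrajectory (T : X →L[ℂ] X) δ x →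
      ∃ y : X, ∀ n : ℤ, ‖(T ^ n) y - x n‖ < ε

end Dynamics

section TwoSidedOrbits

variable {Y : Type*}

theorem eq_of_forall_succ_eq_apply {f : Y → Y} (hf : Function.Injective f) {a b : ℤ → Y}
    (ha : ∀ n, a (n + 1) = f (a n)) (hb : ∀ n, b (n + 1) = f (b n)) (h₀ : a 0 = b 0) : a = b := by
  funext n
  induction n using Int.induction_on with
  | zero => exact h₀
  | succ n ih => rw [ha, hb, ih]
  | pred n ih =>
    apply hf
    rw [← ha, ← hb, sub_add_cancel, ih]

theorem exists_forall_succ_eq_apply (e : ℤ → Y ≃ Y) (y : Y) :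
    ∃ F : ℤ → Y, ∀ n, F (n + 1) = e n (F n) := by
  let S : Equiv.Perm (ℤ × Y) := Equiv.prodShear (Equiv.addRight 1) e
  have succ_apply (n : ℤ) : (S ^ (n + 1)) (0, y) = S ((S ^ n) (0, y)) := by
    rw [← mul_self_zpow, Equiv.Perm.mul_apply]
  have fst_eq : (fun n : ℤ => ((S ^ n) (0, y)).1) = fun n => n :=
    eq_of_forall_succ_eq_apply (add_left_injective 1)
      (fun n => by rw [succ_apply]; rfl) (fun _ => rfl) rfl
  refine ⟨fun n => ((S ^ n) (0, y)).2, fun n => ?_⟩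
  exact (congrArg Prod.snd (succ_apply n)).trans
    (congrArg (fun k => e k ((S ^ n) (0, y)).2) (congrFun fst_eq n))

theorem homeomorph_zpow_add_one_apply [TopologicalSpace Y] (S : Y ≃ₜ Y) (n : ℤ) (y : Y) :
    (S ^ (n + 1)) y = S ((S ^ n) y) := by
  rw [← mul_self_zpow]
  rfl

end TwoSidedOrbits

section GreenKernel

variable {𝕜 X : Type*} [NontriviallyNormedField 𝕜] [NormedAddCommGroup X] [NormedSpace 𝕜 X]

theorem continuousLinearEquiv_zpow_add_one_apply (T : X ≃L[𝕜] X) (n : ℤ) (x : X) :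
    (T ^ (n + 1)) x = T ((T ^ n) x) := by
  rw [← mul_self_zpow]
  rfl

/-- `Γ` is a summable Green kernel of `T`: convolution with `Γ` is a bounded right inverse of
`(y_n) ↦ (y_{n+1} - T y_n)` on bounded two-sided sequences. -/
structure IsGreenKernel (T : X →L[𝕜] X) (Γ : ℤ → X →L[𝕜] X) : Prop where
  summable_norm : Summable fun n => ‖Γ n‖
  apply_sub_one : ∀ n x, Γ (n - 1) x = T (Γ n x) + if n = 0 then x else 0

/-- The value at time `0` of the convolution of a kernel with a sequence; the values at other times
are obtained by translating the sequence. -/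
noncomputable def greenSum (Γ : ℤ → X →L[𝕜] X) (c : ℤ → X) : X := ∑' n, Γ n (c n)

variable {T : X →L[𝕜] X} {Γ : ℤ → X →L[𝕜] X} {c d : ℤ → X} {M : ℝ}

theorem norm_kernel_apply_le (Γ : ℤ → X →L[𝕜] X) (hc : ∀ n, ‖c n‖ ≤ M) (n : ℤ) :
    ‖Γ n (c n)‖ ≤ ‖Γ n‖ * M :=
  (Γ n).le_of_opNorm_le_of_le le_rfl (hc n)

theorem norm_greenSum_le (hΓ : Summable fun n => ‖Γ n‖) (hc : ∀ n, ‖c n‖ ≤ M) :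
    ‖greenSum Γ c‖ ≤ (∑' n, ‖Γ n‖) * M :=
  tsum_of_norm_bounded (hΓ.hasSum.mul_right M) (norm_kernel_apply_le Γ hc)

variable [CompleteSpace X]

theorem summable_kernel_apply (hΓ : Summable fun n => ‖Γ n‖) (hc : ∀ n, ‖c n‖ ≤ M) :
    Summable fun n => Γ n (c n) :=
  .of_norm_bounded (hΓ.mul_right M) (norm_kernel_apply_le Γ hc)

theorem greenSum_sub (hΓ : Summable fun n => ‖Γ n‖) (hc : ∀ n, ‖c n‖ ≤ M)
    (hd : ∀ n, ‖d n‖ ≤ M) :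
    greenSum Γ (fun n => c n - d n) = greenSum Γ c - greenSum Γ d := by
  simp only [greenSum, map_sub]
  exact (summable_kernel_apply hΓ hc).tsum_sub (summable_kernel_apply hΓ hd)

theorem continuous_greenSum {Y : Type*} [TopologicalSpace Y] {c : Y → ℤ → X}
    (hΓ : Summable fun n => ‖Γ n‖) (hc : ∀ y n, ‖c y n‖ ≤ M)
    (hcont : ∀ n, Continuous fun y => c y n) : Continuous fun y => greenSum Γ (c y) :=
  continuous_tsum (fun n => (Γ n).continuous.comp (hcont n)) (hΓ.mul_right M)
    fun n y => norm_kernel_apply_le Γ (hc y) n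

theorem IsGreenKernel.greenSum_succ (hΓ : IsGreenKernel T Γ) (hc : ∀ n, ‖c n‖ ≤ M) :
    greenSum Γ (fun n => c (n + 1)) = T (greenSum Γ c) + c 0 := by
  have hs := summable_kernel_apply hΓ.summable_norm hc
  have hs₀ := (hasSum_ite_eq (0 : ℤ) (c 0)).summable
  calc greenSum Γ (fun n => c (n + 1)) = ∑' n, Γ (n - 1) (c n) := by
        rw [← (Equiv.addRight (1 : ℤ)).tsum_eq fun n => Γ (n - 1) (c n)]
        simp only [greenSum, Equiv.coe_addRight, add_sub_cancel_right]
    _ = ∑' n, (T (Γ n (c n)) + if n = 0 then c 0 else 0) := by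
        refine tsum_congr fun n => ?_
        rw [hΓ.apply_sub_one]
        split_ifs with hn <;> simp [hn]
    _ = T (greenSum Γ c) + c 0 := by
        rw [(T.summable hs).tsum_add hs₀, tsum_ite_eq, greenSum, T.map_tsum hs]

end GreenKernel

section Dichotomy

variable {𝕜 X : Type*} [NontriviallyNormedField 𝕜] [NormedAddCommGroup X] [NormedSpace 𝕜 X]
  {T : X ≃L[𝕜] X} {P : X →L[𝕜] X}

/-- The kernel that propagates the range of `P` forwards and the range of `1 - P` backwards. No
invariance of these ranges under `T` is required. -/
def dichotomyKernel (T : X ≃L[𝕜] X) (P : X →L[𝕜] X) (n : ℤ) : X →L[𝕜] X :=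
  if n < 0 then ((T ^ (-n - 1) : X ≃L[𝕜] X) : X →L[𝕜] X) ∘L P
  else -(((T ^ (-n - 1) : X ≃L[𝕜] X) : X →L[𝕜] X) ∘L (1 - P))

theorem dichotomyKernel_apply_sub_one (n : ℤ) (x : X) :
    dichotomyKernel T P (n - 1) x = T (dichotomyKernel T P n x) + if n = 0 then x else 0 := by
  have hT (y : X) : (T ^ (-(n - 1) - 1)) y = T ((T ^ (-n - 1)) y) := by
    rw [← continuousLinearEquiv_zpow_add_one_apply]
    congr 2
    ring
  rcases lt_trichotomy n 0 with hn | rfl | hn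
  · simp only [dichotomyKernel, if_pos hn, if_pos (hn.trans' (sub_one_lt n)), if_neg hn.ne,
      ContinuousLinearMap.comp_apply, ContinuousLinearEquiv.coe_coe, hT, add_zero]
  · have apply_inv_apply (y : X) : T (T⁻¹ y) = y := T.apply_symm_apply y
    simp [dichotomyKernel, apply_inv_apply]
  · simp only [dichotomyKernel, if_neg hn.not_gt, if_neg (show ¬ n - 1 < 0 by omega),
      if_neg hn.ne', neg_apply, ContinuousLinearMap.comp_apply, ContinuousLinearEquiv.coe_coe,
      hT, map_neg, add_zero]

theorem isGreenKernel_dichotomyKernel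
    (hs : Summable fun m : ℕ => ‖((T ^ (m : ℤ) : X ≃L[𝕜] X) : X →L[𝕜] X) ∘L P‖)
    (hu : Summable fun m : ℕ =>
      ‖((T ^ (-(m : ℤ) - 1) : X ≃L[𝕜] X) : X →L[𝕜] X) ∘L (1 - P)‖) :
    IsGreenKernel (T : X →L[𝕜] X) (dichotomyKernel T P) where
  summable_norm := by
    refine Summable.of_nat_of_neg_add_one (hu.congr fun m => ?_) (hs.congr fun m => ?_)
    · rw [dichotomyKernel, if_neg (by omega), norm_neg]
    · rw [dichotomyKernel, if_pos (by omega), neg_neg, add_sub_cancel_right]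
  apply_sub_one := dichotomyKernel_apply_sub_one

end Dichotomy

section Conjugacy

variable {𝕜 X : Type*} [NontriviallyNormedField 𝕜] [NormedAddCommGroup X] [NormedSpace 𝕜 X]
  {T : X →L[𝕜] X} {Γ : ℤ → X →L[𝕜] X} {S₁ S₂ : X ≃ₜ X} {φ ψ : X → X} {δ M : ℝ}

/-- `S` is a perturbation of the linear map `T` by a `δ`-Lipschitz map bounded by `δ`. -/
structure IsLipschitzPerturbation (T : X →L[𝕜] X) (δ : ℝ) (S : X → X) : Prop where
  norm_sub_le : ∀ x, ‖S x - T x‖ ≤ δ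
  norm_sub_sub_le : ∀ x y, ‖(S x - T x) - (S y - T y)‖ ≤ δ * ‖x - y‖

theorem IsLipschitzPerturbation.nonneg {S : X → X} (hS : IsLipschitzPerturbation T δ S) : 0 ≤ δ :=
  (norm_nonneg _).trans (hS.norm_sub_le 0)

theorem isLipschitzPerturbation_self (T : X →L[𝕜] X) (hδ : 0 ≤ δ) :
    IsLipschitzPerturbation T δ T where
  norm_sub_le x := by rwa [sub_self, norm_zero]
  norm_sub_sub_le x y := by
    rw [sub_self, sub_self, sub_self, norm_zero]
    positivity

/-- The inhomogeneity in the equation `φ (S₁ u) = T (φ u) + conjugacyDefect T S₁ S₂ φ u`, which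
says that `u ↦ u + φ u` intertwines `S₁` with `S₂`. -/
def conjugacyDefect (T : X →L[𝕜] X) (S₁ S₂ φ : X → X) (u : X) : X :=
  (S₂ (u + φ u) - T (u + φ u)) - (S₁ u - T u)

theorem norm_conjugacyDefect_le {S₁ S₂ : X → X} (h₁ : IsLipschitzPerturbation T δ S₁)
    (h₂ : IsLipschitzPerturbation T δ S₂) (φ : X → X) (u : X) :
    ‖conjugacyDefect T S₁ S₂ φ u‖ ≤ 2 * δ :=
  (norm_sub_le_of_le (h₂.norm_sub_le _) (h₁.norm_sub_le _)).trans_eq (two_mul δ).symm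

theorem norm_conjugacyDefect_sub_le {S₂ : X → X} (h₂ : IsLipschitzPerturbation T δ S₂)
    (S₁ φ ψ : X → X) (u : X) :
    ‖conjugacyDefect T S₁ S₂ φ u - conjugacyDefect T S₁ S₂ ψ u‖ ≤ δ * ‖φ u - ψ u‖ := by
  simpa only [conjugacyDefect, sub_sub_sub_cancel_right, add_sub_add_left_eq_sub] using
    h₂.norm_sub_sub_le (u + φ u) (u + ψ u)

/-- The bounded solution of the conjugacy equation whose inhomogeneity is frozen at `φ`. Its fixed
points are the bounded `φ` such that `u ↦ u + φ u` intertwines `S₁` with `S₂`. -/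
noncomputable def conjugacyMap (Γ : ℤ → X →L[𝕜] X) (T : X →L[𝕜] X) (S₁ S₂ : X ≃ₜ X)
    (φ : X → X) (x : X) : X :=
  greenSum Γ fun n => conjugacyDefect T S₁ S₂ φ ((S₁ ^ n) x)

theorem norm_conjugacyMap_le (hΓ : Summable fun n => ‖Γ n‖) (h₁ : IsLipschitzPerturbation T δ S₁)
    (h₂ : IsLipschitzPerturbation T δ S₂) (φ : X → X) (x : X) :
    ‖conjugacyMap Γ T S₁ S₂ φ x‖ ≤ (∑' n, ‖Γ n‖) * (2 * δ) :=
  norm_greenSum_le hΓ fun _ => norm_conjugacyDefect_le h₁ h₂ φ _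

variable [CompleteSpace X]

theorem norm_conjugacyMap_sub_le (hΓ : Summable fun n => ‖Γ n‖)
    (h₁ : IsLipschitzPerturbation T δ S₁) (h₂ : IsLipschitzPerturbation T δ S₂)
    (hM : ∀ x, ‖φ x - ψ x‖ ≤ M) (x : X) :
    ‖conjugacyMap Γ T S₁ S₂ φ x - conjugacyMap Γ T S₁ S₂ ψ x‖ ≤ (∑' n, ‖Γ n‖) * (δ * M) := by
  rw [conjugacyMap, conjugacyMap,
    ← greenSum_sub hΓ (fun _ => norm_conjugacyDefect_le h₁ h₂ φ _)
      (fun _ => norm_conjugacyDefect_le h₁ h₂ ψ _)]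
  exact norm_greenSum_le hΓ fun n => (norm_conjugacyDefect_sub_le h₂ S₁ φ ψ _).trans
    (mul_le_mul_of_nonneg_left (hM _) h₂.nonneg)

theorem continuous_conjugacyMap (hΓ : Summable fun n => ‖Γ n‖)
    (h₁ : IsLipschitzPerturbation T δ S₁) (h₂ : IsLipschitzPerturbation T δ S₂)
    (hφ : Continuous φ) : Continuous (conjugacyMap Γ T S₁ S₂ φ) := by
  refine continuous_greenSum hΓ (fun _ _ => norm_conjugacyDefect_le h₁ h₂ φ _) fun n => ?_
  have hdefect : Continuous (conjugacyDefect T S₁ S₂ φ) := by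
    unfold conjugacyDefect
    fun_prop
  exact hdefect.comp (S₁ ^ n).continuous

theorem exists_continuous_conjugacyMap_eq (hΓ : Summable fun n => ‖Γ n‖)
    (h₁ : IsLipschitzPerturbation T δ S₁) (h₂ : IsLipschitzPerturbation T δ S₂)
    (hΓδ : (∑' n, ‖Γ n‖) * δ < 1) :
    ∃ φ : X → X, Continuous φ ∧ conjugacyMap Γ T S₁ S₂ φ = φ := by
  let F (φ : BoundedContinuousFunction X X) : BoundedContinuousFunction X X :=
    .ofNormedAddCommGroup (conjugacyMap Γ T S₁ S₂ φ)
      (continuous_conjugacyMap hΓ h₁ h₂ φ.continuous) _ (norm_conjugacyMap_le hΓ h₁ h₂ φ)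
  have hΓ₀ : 0 ≤ ∑' n, ‖Γ n‖ := tsum_nonneg fun n => norm_nonneg _
  have hF : ContractingWith (.mk _ (mul_nonneg hΓ₀ h₁.nonneg)) F := by
    refine ⟨hΓδ, LipschitzWith.of_dist_le_mul fun φ ψ => ?_⟩
    refine (BoundedContinuousFunction.dist_le (mul_nonneg (NNReal.coe_nonneg _) dist_nonneg)).2
      fun x => ?_
    rw [dist_eq_norm, NNReal.coe_mk, mul_assoc]
    exact norm_conjugacyMap_sub_le hΓ h₁ h₂
      (fun y => (dist_eq_norm (φ y) (ψ y)).symm.trans_le (φ.dist_coe_le_dist y)) x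
  exact ⟨_, (ContractingWith.fixedPoint F hF).continuous,
    congrArg DFunLike.coe hF.fixedPoint_isFixedPt⟩

theorem eq_of_conjugacyMap_eq (hΓ : Summable fun n => ‖Γ n‖)
    (h₁ : IsLipschitzPerturbation T δ S₁) (h₂ : IsLipschitzPerturbation T δ S₂)
    (hΓδ : (∑' n, ‖Γ n‖) * δ < 1) (hφ : conjugacyMap Γ T S₁ S₂ φ = φ)
    (hψ : conjugacyMap Γ T S₁ S₂ ψ = ψ) : φ = ψ := by
  have hbdd : BddAbove (Set.range fun x => ‖φ x - ψ x‖) := by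
    refine ⟨(∑' n, ‖Γ n‖) * (2 * δ) + (∑' n, ‖Γ n‖) * (2 * δ), ?_⟩
    rintro _ ⟨x, rfl⟩
    rw [← hφ, ← hψ]
    exact norm_sub_le_of_le (norm_conjugacyMap_le hΓ h₁ h₂ φ x) (norm_conjugacyMap_le hΓ h₁ h₂ ψ x)
  have hsup : ⨆ x, ‖φ x - ψ x‖ ≤ (∑' n, ‖Γ n‖) * (δ * ⨆ x, ‖φ x - ψ x‖) := by
    refine ciSup_le fun x => ?_
    conv_lhs => rw [← hφ, ← hψ]
    exact norm_conjugacyMap_sub_le hΓ h₁ h₂ (le_ciSup hbdd) x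
  funext x
  have hx := le_ciSup hbdd x
  exact sub_eq_zero.1 (norm_le_zero_iff.1 (by nlinarith))

theorem IsGreenKernel.apply_add_of_conjugacyMap_eq (hΓ : IsGreenKernel T Γ)
    (h₁ : IsLipschitzPerturbation T δ S₁) (h₂ : IsLipschitzPerturbation T δ S₂)
    (hφ : conjugacyMap Γ T S₁ S₂ φ = φ) (x : X) : S₂ (x + φ x) = S₁ x + φ (S₁ x) := by
  have shift (n : ℤ) : (S₁ ^ n) (S₁ x) = (S₁ ^ (n + 1)) x := by
    rw [← mul_zpow_self]
    rfl
  have hsucc : φ (S₁ x) = T (φ x) + conjugacyDefect T S₁ S₂ φ x := by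
    calc φ (S₁ x) = greenSum Γ fun n => conjugacyDefect T S₁ S₂ φ ((S₁ ^ (n + 1)) x) := by
          simp only [← shift]
          exact congrFun hφ.symm _
      _ = T (conjugacyMap Γ T S₁ S₂ φ x) + conjugacyDefect T S₁ S₂ φ x :=
          hΓ.greenSum_succ (c := fun n => conjugacyDefect T S₁ S₂ φ ((S₁ ^ n) x))
            fun _ => norm_conjugacyDefect_le h₁ h₂ φ _
      _ = T (φ x) + conjugacyDefect T S₁ S₂ φ x := by rw [hφ]
  rw [hsucc, conjugacyDefect, map_add T]
  abel

theorem IsGreenKernel.zpow_apply_add_of_conjugacyMap_eq (hΓ : IsGreenKernel T Γ)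
    (h₁ : IsLipschitzPerturbation T δ S₁) (h₂ : IsLipschitzPerturbation T δ S₂)
    (hφ : conjugacyMap Γ T S₁ S₂ φ = φ) (n : ℤ) (x : X) :
    (S₂ ^ n) (x + φ x) = (S₁ ^ n) x + φ ((S₁ ^ n) x) := by
  refine congrFun (eq_of_forall_succ_eq_apply (a := fun n => (S₂ ^ n) (x + φ x))
    (b := fun n => (S₁ ^ n) x + φ ((S₁ ^ n) x)) S₂.injective
    (fun n => homeomorph_zpow_add_one_apply S₂ n _) (fun n => ?_) rfl) n
  rw [homeomorph_zpow_add_one_apply, hΓ.apply_add_of_conjugacyMap_eq h₁ h₂ hφ]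

/-- The composition of the two solutions solves the conjugacy equation from `S₁` to itself, whose
only bounded solution is zero. -/
theorem IsGreenKernel.leftInverse_of_conjugacyMap_eq (hΓ : IsGreenKernel T Γ)
    (h₁ : IsLipschitzPerturbation T δ S₁) (h₂ : IsLipschitzPerturbation T δ S₂)
    (hΓδ : (∑' n, ‖Γ n‖) * δ < 1) (hφ : conjugacyMap Γ T S₁ S₂ φ = φ)
    (hψ : conjugacyMap Γ T S₂ S₁ ψ = ψ) :
    Function.LeftInverse (fun x => x + ψ x) (fun x => x + φ x) := by
  have hzero : conjugacyMap Γ T S₁ S₁ (fun _ => 0) = fun _ => 0 := by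
    funext x
    simp [conjugacyMap, conjugacyDefect, greenSum]
  have hcomp : conjugacyMap Γ T S₁ S₁ (fun x => φ x + ψ (x + φ x)) =
      fun x => φ x + ψ (x + φ x) := by
    funext x
    have hdefect (n : ℤ) : conjugacyDefect T S₁ S₂ φ ((S₁ ^ n) x) =
        conjugacyDefect T S₁ S₁ (fun x => φ x + ψ (x + φ x)) ((S₁ ^ n) x) -
          conjugacyDefect T S₂ S₁ ψ ((S₂ ^ n) (x + φ x)) := by
      rw [hΓ.zpow_apply_add_of_conjugacyMap_eq h₁ h₂ hφ]
      simp only [conjugacyDefect, ← add_assoc]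
      abel
    refine eq_add_of_sub_eq ?_
    calc conjugacyMap Γ T S₁ S₁ (fun x => φ x + ψ (x + φ x)) x - ψ (x + φ x)
        = conjugacyMap Γ T S₁ S₁ (fun x => φ x + ψ (x + φ x)) x -
            conjugacyMap Γ T S₂ S₁ ψ (x + φ x) := by rw [hψ]
      _ = conjugacyMap Γ T S₁ S₂ φ x := by
          simp only [conjugacyMap, hdefect]
          exact (greenSum_sub hΓ.summable_norm (fun _ => norm_conjugacyDefect_le h₁ h₁ _ _)
            fun _ => norm_conjugacyDefect_le h₂ h₁ _ _).symm
      _ = φ x := by rw [hφ]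
  intro x
  have hx := congrFun (eq_of_conjugacyMap_eq hΓ.summable_norm h₁ h₁ hΓδ hcomp hzero) x
  simp only at hx ⊢
  rw [add_assoc, hx, add_zero]

theorem IsGreenKernel.exists_conjugacy (hΓ : IsGreenKernel T Γ)
    (h₁ : IsLipschitzPerturbation T δ S₁) (h₂ : IsLipschitzPerturbation T δ S₂)
    (hΓδ : (∑' n, ‖Γ n‖) * δ < 1) :
    ∃ φ : X → X, (∀ x, ‖φ x‖ ≤ (∑' n, ‖Γ n‖) * (2 * δ)) ∧ IsHomeomorph (fun x => x + φ x) ∧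
      ∀ x, S₂ (x + φ x) = S₁ x + φ (S₁ x) := by
  obtain ⟨φ, hφ_cont, hφ⟩ := exists_continuous_conjugacyMap_eq hΓ.summable_norm h₁ h₂ hΓδ
  obtain ⟨ψ, hψ_cont, hψ⟩ := exists_continuous_conjugacyMap_eq hΓ.summable_norm h₂ h₁ hΓδ
  have hleft := hΓ.leftInverse_of_conjugacyMap_eq h₁ h₂ hΓδ hφ hψ
  have hright := hΓ.leftInverse_of_conjugacyMap_eq h₂ h₁ hΓδ hψ hφ
  refine ⟨φ, fun x => ?_, ?_, hΓ.apply_add_of_conjugacyMap_eq h₁ h₂ hφ⟩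
  · conv_lhs => rw [← hφ]
    exact norm_conjugacyMap_le hΓ.summable_norm h₁ h₂ φ x
  · exact (Homeomorph.mk ⟨_, _, hleft, hright⟩ (continuous_id.add hφ_cont)
      (continuous_id.add hψ_cont)).isHomeomorph

end Conjugacy

section Stability

open scoped Topology

variable {X : Type*} [NormedAddCommGroup X] [CompleteSpace X]

theorem exists_homeomorph_add {𝕜 : Type*} [NontriviallyNormedField 𝕜] [NormedSpace 𝕜 X]
    (T : X ≃L[𝕜] X) {α : X → X} {δ : ℝ} (hδ : 0 ≤ δ) (hTδ : ‖(T.symm : X →L[𝕜] X)‖ * δ < 1)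
    (hα : ∀ x y, ‖α x - α y‖ ≤ δ * ‖x - y‖) : ∃ S : X ≃ₜ X, ∀ x, S x = T x + α x := by
  lift δ to NNReal using hδ
  have happrox : ApproximatesLinearOn (fun x => T x + α x) (T : X →L[𝕜] X) Set.univ δ := by
    intro x _ y _
    rw [ContinuousLinearEquiv.coe_coe, map_sub, add_sub_add_comm, add_sub_cancel_left]
    exact hα x y
  refine ⟨happrox.toHomeomorph _ (T.subsingleton_or_nnnorm_symm_pos.imp_right fun hpos => ?_),
    fun x => rfl⟩
  rw [← one_div, lt_div_iff₀' hpos]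
  exact_mod_cast hTδ

variable [NormedSpace ℂ X] {T : X ≃L[ℂ] X} {Γ : ℤ → X →L[ℂ] X}

theorem IsGreenKernel.stronglyStructurallyStable (hΓ : IsGreenKernel (T : X →L[ℂ] X) Γ) :
    StronglyStructurallyStable (T : X →L[ℂ] X) := by
  intro ε hε
  have hsmall (C : ℝ) {r : ℝ} (hr : 0 < r) : ∀ᶠ δ in 𝓝[>] (0 : ℝ), C * δ < r :=
    (((continuous_const_mul C).tendsto' 0 0 (mul_zero C)).eventually
      (gt_mem_nhds hr)).filter_mono nhdsWithin_le_nhds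
  obtain ⟨δ, ⟨⟨hδ_close, hΓδ⟩, hTδ⟩, hδ⟩ := (((hsmall ((∑' n, ‖Γ n‖) * 2) hε).and
    (hsmall (∑' n, ‖Γ n‖) one_pos)).and (hsmall ‖(T.symm : X →L[ℂ] X)‖ one_pos)).and
    self_mem_nhdsWithin |>.exists
  refine ⟨δ, hδ, fun α hα_le hα_lip => ?_⟩
  obtain ⟨S, hS⟩ := exists_homeomorph_add T hδ.le hTδ hα_lip
  have hS_pert : IsLipschitzPerturbation (T : X →L[ℂ] X) δ S := by
    constructor <;> simpa [hS]
  obtain ⟨φ, hφ_le, hφ_homeo, hφ⟩ := hΓ.exists_conjugacy (S₂ := T.toHomeomorph) hS_pert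
    (isLipschitzPerturbation_self _ hδ.le) hΓδ
  refine ⟨φ, fun x => (hφ_le x).trans ?_, hφ_homeo, fun x => (hφ x).trans ?_⟩
  · rw [← mul_assoc]
    exact hδ_close.le
  · rw [hS]
    rfl

theorem IsGreenKernel.hasShadowing (hΓ : IsGreenKernel (T : X →L[ℂ] X) Γ) : HasShadowing T := by
  intro ε hε
  obtain ⟨δ, hδ, hΓδ⟩ := exists_pos_mul_lt hε (∑' n, ‖Γ n‖)
  refine ⟨δ, hδ, fun x hx => ?_⟩
  let c (n : ℤ) : X := x (n + 1) - T (x n)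
  have hc (n : ℤ) : ‖c n‖ ≤ δ := (norm_sub_rev _ _).trans_le (hx n)
  let y (m : ℤ) : X := greenSum Γ fun n => c (n + m)
  have hy (m : ℤ) : y (m + 1) = T (y m) + (x (m + 1) - T (x m)) := by
    have hsucc := hΓ.greenSum_succ (c := fun n => c (n + m)) fun n => hc (n + m)
    simp only [zero_add, add_assoc, add_comm 1 m] at hsucc
    exact hsucc
  have horbit : (fun n => (T ^ n) (x 0 - y 0)) = fun n => x n - y n :=
    eq_of_forall_succ_eq_apply T.injective
      (fun n => continuousLinearEquiv_zpow_add_one_apply T n _)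
      (fun n => by rw [hy, map_sub]; abel) rfl
  refine ⟨x 0 - y 0, fun n => ?_⟩
  calc ‖(T ^ n) (x 0 - y 0) - x n‖ = ‖y n‖ := by
        rw [congrFun horbit n, sub_sub_cancel_left, norm_neg]
    _ ≤ (∑' n, ‖Γ n‖) * δ := norm_greenSum_le hΓ.summable_norm fun k => hc (k + n)
    _ < ε := hΓδ

end Stability

section DominatedPrimitive

theorem exists_forall_abs_sub_le {ι : Type*} [Nonempty ι] {u r : ι → ℝ}
    (h : ∀ i j, u i - u j ≤ r i + r j) : ∃ a, ∀ j, |u j - a| ≤ r j := by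
  have hbdd (j : ι) : u j + r j ∈ upperBounds (Set.range fun i => u i - r i) := by
    rintro _ ⟨i, rfl⟩
    linarith [h i j]
  refine ⟨⨆ i, (u i - r i), fun j => abs_le.2 ⟨?_, ?_⟩⟩
  · linarith [ciSup_le (hbdd j <| Set.mem_range_self ·)]
  · linarith [le_ciSup ⟨_, hbdd j⟩ j]

theorem exists_forall_eq_succ_add (v : ℤ → ℝ) : ∃ U : ℤ → ℝ, ∀ k, U k = U (k + 1) + v k := by
  obtain ⟨U, hU⟩ := exists_forall_succ_eq_apply (fun k => Equiv.subRight (v k)) 0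
  exact ⟨U, fun k => by rw [hU, Equiv.subRight_apply, sub_add_cancel]⟩

theorem antitone_of_eq_succ_add {v U : ℤ → ℝ} (hU : ∀ k, U k = U (k + 1) + v k)
    (hv : ∀ k, 0 ≤ v k) : Antitone U :=
  antitone_int_of_succ_le fun k => by linarith [hU k, hv k]

variable {v s : ℤ → ℝ} {K : ℝ}

/-- `s` is a discrete primitive of `-v` that is dominated by `K * v`. -/
structure IsDominatedPrimitive (v s : ℤ → ℝ) (K : ℝ) : Prop where
  eq_succ_add : ∀ k, s k = s (k + 1) + v k
  abs_le : ∀ k, |s k| ≤ K * v k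

namespace IsDominatedPrimitive

theorem sub_const {U : ℤ → ℝ} {a : ℝ} (hU : ∀ k, U k = U (k + 1) + v k)
    (h : ∀ k, |U k - a| ≤ K * v k) : IsDominatedPrimitive v (fun k => U k - a) K where
  eq_succ_add k := by rw [hU]; ring
  abs_le := h

theorem nonneg (h : IsDominatedPrimitive v s K) (hv : ∀ k, 0 < v k) : 0 ≤ K :=
  nonneg_of_mul_nonneg_left ((abs_nonneg _).trans (h.abs_le 0)) (hv 0)

theorem succ_le (h : IsDominatedPrimitive v s K) (hv : ∀ k, 0 < v k) (k : ℤ) :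
    s (k + 1) ≤ K / (K + 1) * s k := by
  have hK := h.nonneg hv
  rw [div_mul_eq_mul_div, le_div_iff₀ (by positivity)]
  linear_combination le_of_abs_le (h.abs_le k) + (hv k).le - (K + 1) * h.eq_succ_add k

theorem neg_le_neg_succ (h : IsDominatedPrimitive v s K) (hv : ∀ k, 0 < v k) (k : ℤ) :
    -s k ≤ K / (K + 1) * -s (k + 1) := by
  have hK := h.nonneg hv
  rw [div_mul_eq_mul_div, le_div_iff₀ (by positivity)]
  linear_combination neg_le_of_abs_le (h.abs_le k) - K * h.eq_succ_add k

theorem le_geom_sub (h : IsDominatedPrimitive v s K) (hv : ∀ k, 0 < v k) {k : ℤ}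
    (hk : 0 ≤ s k + s (k + 1)) (m : ℕ) : v k ≤ 2 * K * (K / (K + 1)) ^ m * v (k - m) := by
  have hK := h.nonneg hv
  have hgeom : s k ≤ (K / (K + 1)) ^ m * s (k - m) := by
    have := le_geom (u := fun i : ℕ => s (k - m + i)) (c := K / (K + 1)) (by positivity) m
      fun i _ => by simpa only [Nat.cast_succ, add_assoc] using h.succ_le hv (k - m + i)
    simpa using this
  calc v k ≤ 2 * s k := by linarith [h.eq_succ_add k]
    _ ≤ 2 * ((K / (K + 1)) ^ m * (K * v (k - m))) := by
        gcongr
        exact hgeom.trans (by gcongr; exact le_of_abs_le (h.abs_le _))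
    _ = 2 * K * (K / (K + 1)) ^ m * v (k - m) := by ring

theorem le_geom_add (h : IsDominatedPrimitive v s K) (hv : ∀ k, 0 < v k) {k : ℤ}
    (hk : s k + s (k + 1) ≤ 0) (m : ℕ) : v k ≤ 2 * K * (K / (K + 1)) ^ m * v (k + 1 + m) := by
  have hK := h.nonneg hv
  have hgeom : -s (k + 1) ≤ (K / (K + 1)) ^ m * -s (k + 1 + m) := by
    have := le_geom (u := fun i : ℕ => -s (k + 1 + m - i)) (c := K / (K + 1)) (by positivity) m
      fun i _ => by
        simpa only [Nat.cast_succ, ← sub_sub, sub_add_cancel] using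
          h.neg_le_neg_succ hv (k + 1 + m - i - 1)
    simpa using this
  calc v k ≤ 2 * -s (k + 1) := by linarith [h.eq_succ_add k]
    _ ≤ 2 * ((K / (K + 1)) ^ m * (K * v (k + 1 + m))) := by
        gcongr
        exact hgeom.trans (by gcongr; exact neg_le_of_abs_le (h.abs_le _) |> neg_le.1)
    _ = 2 * K * (K / (K + 1)) ^ m * v (k + 1 + m) := by ring

theorem summable_geom (h : IsDominatedPrimitive v s K) (hv : ∀ k, 0 < v k) :
    Summable fun m : ℕ => 2 * K * (K / (K + 1)) ^ m := by
  have hK := h.nonneg hv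
  exact (summable_geometric_of_lt_one (by positivity)
    ((div_lt_one (by positivity)).2 (lt_add_one K))).mul_left _

end IsDominatedPrimitive

end DominatedPrimitive

section RadialRetraction

variable {V : Type*} [NormedAddCommGroup V] [NormedSpace ℝ V]

/-- The radial retraction onto the closed unit ball. -/
noncomputable def radialRetraction (x : V) : V := (max 1 ‖x‖)⁻¹ • x

theorem norm_radialRetraction_le_one (x : V) : ‖radialRetraction x‖ ≤ 1 := by
  rw [radialRetraction, norm_smul, norm_inv, Real.norm_of_nonneg (by positivity),
    inv_mul_le_iff₀ (by positivity), mul_one]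
  exact le_max_right _ _

theorem norm_radialRetraction_sub_le (x y : V) :
    ‖radialRetraction x - radialRetraction y‖ ≤ 2 * ‖x - y‖ := by
  have hmax : ‖max 1 ‖y‖ - max 1 ‖x‖‖ ≤ ‖x - y‖ := by
    rw [norm_sub_rev x y, Real.norm_eq_abs, max_comm 1, max_comm 1]
    exact (abs_max_sub_max_le_abs ‖y‖ ‖x‖ 1).trans (abs_norm_sub_norm_le y x)
  have hy : max 1 ‖y‖ • radialRetraction y = y := smul_inv_smul₀ (by positivity) y
  have hdiff : radialRetraction x - radialRetraction y =
      (max 1 ‖x‖)⁻¹ • ((x - y) + (max 1 ‖y‖ - max 1 ‖x‖) • radialRetraction y) := by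
    rw [sub_smul, hy, sub_add_sub_cancel, smul_sub, inv_smul_smul₀ (by positivity)]
    rfl
  calc ‖radialRetraction x - radialRetraction y‖
      ≤ 1 * (‖x - y‖ + ‖x - y‖ * 1) := by
        rw [hdiff, norm_smul]
        gcongr
        · rw [norm_inv, Real.norm_of_nonneg (by positivity)]
          exact inv_le_one_of_one_le₀ (le_max_left _ _)
        · refine norm_add_le_of_le le_rfl ?_
          rw [norm_smul]
          gcongr
          exact norm_radialRetraction_le_one y
    _ = 2 * ‖x - y‖ := by ring

theorem radialRetraction_smul {r : ℝ} {x : V} (hr : 0 < r) (hx : 1 ≤ r * ‖x‖) :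
    radialRetraction (r • x) = ‖x‖⁻¹ • x := by
  rw [radialRetraction, norm_smul, Real.norm_of_nonneg hr.le, max_eq_right hx, smul_smul,
    mul_inv_rev, inv_mul_cancel_right₀ hr.ne']

end RadialRetraction

section SequenceSpaces

variable {X : Type*} [NormedAddCommGroup X] [NormedSpace ℂ X]

/-- A normed space of complex sequences indexed by `ℤ` which contains the unit vectors and in which
a sequence belongs to the space, with the expected norm bound, as soon as it is dominated by a
translate of an element of the space. The comparison is made in units of the norms of the unit
vectors, so that weighted `ℓ_p` and `c_0` spaces are included. -/
structure SequenceSpace (X : Type*) [NormedAddCommGroup X] [NormedSpace ℂ X] where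
  coord : X →ₗ[ℂ] ℤ → ℂ
  coord_injective : Function.Injective coord
  single : ℤ → X
  coord_single : ∀ k, coord (single k) = Pi.single k 1
  exists_norm_le_of_dominated : ∀ (x : X) (u : ℤ → ℂ) (m : ℤ),
    (∀ k, ‖u k‖ * ‖single k‖ ≤ ‖coord x (k + m)‖ * ‖single (k + m)‖) →
      ∃ y, coord y = u ∧ ‖y‖ ≤ ‖x‖

namespace SequenceSpace

variable (E : SequenceSpace X) {T : X ≃L[ℂ] X}

theorem coord_single_self (k : ℤ) : E.coord (E.single k) k = 1 := by
  rw [E.coord_single, Pi.single_eq_same]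

theorem coord_smul_single (r : ℝ) (k : ℤ) : E.coord (r • E.single k) k = r := by
  rw [← Complex.coe_smul, map_smul, Pi.smul_apply, E.coord_single_self, smul_eq_mul, mul_one]

theorem norm_single_pos (k : ℤ) : 0 < ‖E.single k‖ := by
  refine norm_pos_iff.2 fun h => one_ne_zero (α := ℂ) ?_
  rw [← E.coord_single_self k, h, map_zero, Pi.zero_apply]

/-- The norm of the `k`-th coordinate functional, see `norm_coord_le`. -/
noncomputable def weight (k : ℤ) : ℝ := ‖E.single k‖⁻¹

theorem weight_pos (k : ℤ) : 0 < E.weight k := inv_pos.2 (E.norm_single_pos k)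

theorem weight_mul_norm_single (k : ℤ) : E.weight k * ‖E.single k‖ = 1 :=
  inv_mul_cancel₀ (E.norm_single_pos k).ne'

theorem norm_coord_le (x : X) (k : ℤ) : ‖E.coord x k‖ ≤ E.weight k * ‖x‖ := by
  obtain ⟨y, hy, hyx⟩ := E.exists_norm_le_of_dominated x (Pi.single k (E.coord x k)) 0 fun j => by
    rw [add_zero]
    gcongr
    rcases eq_or_ne j k with rfl | hjk
    · rw [Pi.single_eq_same]
    · rw [Pi.single_eq_of_ne hjk, norm_zero]
      exact norm_nonneg _
  have hy_eq : y = E.coord x k • E.single k := by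
    apply E.coord_injective
    rw [hy, map_smul, E.coord_single, ← Pi.single_smul, smul_eq_mul, mul_one]
  rwa [hy_eq, norm_smul, ← le_div_iff₀ (E.norm_single_pos k), div_eq_inv_mul] at hyx

theorem norm_coord_le_of_le {x : X} {C : ℝ} (hx : ‖x‖ ≤ C) (k : ℤ) :
    ‖E.coord x k‖ ≤ E.weight k * C :=
  (E.norm_coord_le x k).trans (mul_le_mul_of_nonneg_left hx (E.weight_pos k).le)

/-- The sequence space with coordinates rescaled by `v`. -/
noncomputable def reweight (v : ℤ → ℂˣ) : SequenceSpace X where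
  coord := LinearMap.pi fun k => (v k : ℂ) • LinearMap.proj k ∘ₗ E.coord
  coord_injective x y h := E.coord_injective <| funext fun k =>
    mul_left_cancel₀ (v k).ne_zero (congrFun h k)
  single k := (↑(v k)⁻¹ : ℂ) • E.single k
  coord_single k := by
    funext j
    rcases eq_or_ne j k with rfl | hjk <;> simp [E.coord_single, *]
  exists_norm_le_of_dominated x u m h := by
    obtain ⟨y, hy, hyx⟩ := E.exists_norm_le_of_dominated x (fun k => ↑(v k)⁻¹ * u k) m fun k => by
      simpa [norm_smul, mul_assoc, mul_left_comm, (v _).ne_zero] using h k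
    refine ⟨y, funext fun k => ?_, hyx⟩
    simp [hy]

theorem exists_coord_eq_indicator (A : Set ℤ) :
    ∃ P : X →L[ℂ] X, ∀ x, E.coord (P x) = A.indicator (E.coord x) := by
  choose P hP_coord hP_norm using fun x : X =>
    E.exists_norm_le_of_dominated x (A.indicator (E.coord x)) 0 fun k => by
      rw [add_zero]
      gcongr
      exact norm_indicator_le_norm_self _ _
  let P' : X →ₗ[ℂ] X :=
    { toFun := P
      map_add' x y := E.coord_injective <| by
        rw [map_add, hP_coord, hP_coord, hP_coord, map_add, Set.indicator_add']
      map_smul' c x := E.coord_injective <| by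
        rw [map_smul, hP_coord, hP_coord, map_smul, RingHom.id_apply]
        exact Set.indicator_const_smul A c _ }
  exact ⟨P'.mkContinuous 1 fun x => by rw [one_mul]; exact hP_norm x, hP_coord⟩

/-- `T` acts on coordinates as the unweighted backward shift. -/
def IsBackwardShift (T : X → X) : Prop := ∀ x k, E.coord (T x) k = E.coord x (k + 1)

theorem exists_isBackwardShift_reweight {w : ℤ → ℝ}
    (hT : ∀ x, E.coord (T x) = bilateralShift w (E.coord x)) :
    ∃ v : ℤ → ℂˣ, (E.reweight v).IsBackwardShift T := by
  have hw (k : ℤ) : (w (k + 1) : ℂ) ≠ 0 := by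
    intro hk
    have hcoord := congrFun (hT (T.symm (E.single k))) k
    rw [T.apply_symm_apply, E.coord_single_self, bilateralShift, hk, zero_mul] at hcoord
    exact one_ne_zero hcoord
  obtain ⟨v, hv⟩ := exists_forall_succ_eq_apply (fun k => Equiv.mulLeft (Units.mk0 _ (hw k))) 1
  refine ⟨v, fun x k => ?_⟩
  simp [reweight, hT, hv, bilateralShift, mul_comm, mul_assoc]

namespace IsBackwardShift

variable {E}

theorem coord_zpow_apply (hT : E.IsBackwardShift T) (x : X) (n k : ℤ) :
    E.coord ((T ^ n) x) k = E.coord x (k + n) := by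
  have horbit : (fun n => E.coord ((T ^ n) x)) = fun n k => E.coord x (k + n) :=
    eq_of_forall_succ_eq_apply (f := fun u k => u (k + 1))
      (fun u u' h => funext fun k => by simpa using congrFun h (k - 1))
      (fun n => funext fun k => by rw [continuousLinearEquiv_zpow_add_one_apply, hT])
      (fun n => funext fun k => congrArg (E.coord x) (by ring))
      (funext fun k => by rw [add_zero]; rfl)
  exact congrFun (congrFun horbit n) k

theorem apply_smul_single (hT : E.IsBackwardShift T) (r : ℝ) (k : ℤ) :
    T (r • E.single (k + 1)) = r • E.single k := by
  apply E.coord_injective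
  funext j
  rw [hT, ← Complex.coe_smul, ← Complex.coe_smul, map_smul, map_smul, E.coord_single,
    E.coord_single]
  simp only [Pi.smul_apply, Pi.single_apply, add_left_inj]

theorem exists_isDominatedPrimitive_of_hasShadowing (hT : E.IsBackwardShift T)
    (hshadow : HasShadowing T) : ∃ s K, IsDominatedPrimitive E.weight s K := by
  obtain ⟨U, hU⟩ := exists_forall_eq_succ_add E.weight
  obtain ⟨δ, hδ, hshadow⟩ := hshadow 1 one_pos
  -- The error at time `-(k + 1)` is the `k`-th unit vector scaled to norm `δ`.
  let x (n : ℤ) : X := (δ * U (-n)) • E.single (-n)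
  have hx : IsPseudotrajectory (T : X →L[ℂ] X) δ x := by
    intro n
    obtain ⟨k, rfl⟩ : ∃ k, n = -(k + 1) := ⟨-n - 1, by ring⟩
    have hstep : T (x (-(k + 1))) - x (-(k + 1) + 1) = -(δ * E.weight k) • E.single k := by
      simp only [x, neg_neg, neg_add_rev, neg_add_cancel_comm]
      rw [hT.apply_smul_single, ← sub_smul, hU k]
      congr 1
      ring
    rw [ContinuousLinearEquiv.coe_coe, hstep, norm_smul, norm_neg,
      Real.norm_of_nonneg (mul_pos hδ (E.weight_pos k)).le, mul_assoc, E.weight_mul_norm_single,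
      mul_one]
  obtain ⟨y, hy⟩ := hshadow x hx
  refine ⟨_, δ⁻¹, .sub_const hU (a := δ⁻¹ * (E.coord y 0).re) fun k => ?_⟩
  have hyk : E.coord ((T ^ (-k)) y - x (-k)) k = E.coord y 0 - (δ * U k : ℝ) := by
    rw [map_sub, Pi.sub_apply, hT.coord_zpow_apply, add_neg_cancel]
    simp only [x, neg_neg, E.coord_smul_single]
  calc |U k - δ⁻¹ * (E.coord y 0).re| = δ⁻¹ * |(E.coord y 0 - (δ * U k : ℝ)).re| := by
        rw [Complex.sub_re, Complex.ofReal_re, abs_sub_comm (E.coord y 0).re,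
          ← abs_of_pos (inv_pos.2 hδ), ← abs_mul, abs_of_pos (inv_pos.2 hδ), mul_sub,
          inv_mul_cancel_left₀ hδ.ne']
    _ ≤ δ⁻¹ * (E.weight k * 1) := by
        rw [← hyk]
        gcongr
        exact (Complex.abs_re_le_norm _).trans (E.norm_coord_le_of_le (hy (-k)).le k)
    _ = δ⁻¹ * E.weight k := by rw [mul_one]

theorem mul_sub_le_of_conjugacy (hT : E.IsBackwardShift T) {U : ℤ → ℝ}
    (hU : ∀ k, U k = U (k + 1) + E.weight k) {κ : ℝ} (hκ : 0 < κ) {φ : X → X}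
    (hφ : ∀ x, ‖φ x‖ ≤ 1)
    (hconj : ∀ x, T (x + φ x) =
      (T x + κ • radialRetraction (T x)) + φ (T x + κ • radialRetraction (T x)))
    {i j : ℤ} (hij : i ≤ j) : κ * (U i - U j) ≤ E.weight i + E.weight j := by
  have hanti := antitone_of_eq_succ_add hU fun k => (E.weight_pos k).le
  -- Along this segment `T (x (k + 1))` has norm at least `1`, so the retraction normalises it and
  -- the perturbation adds exactly the `k`-th unit vector scaled to norm `κ`.
  let x (k : ℤ) : X := (U i - U j + κ * (U k - U j)) • E.single k
  have hx {k : ℤ} (hik : i ≤ k) (hkj : k + 1 ≤ j) :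
      T (x (k + 1)) + κ • radialRetraction (T (x (k + 1))) = x k := by
    have hlarge : E.weight k ≤ U i - U j + κ * (U (k + 1) - U j) := by
      nlinarith [hU k, hanti hik, hanti hkj]
    have hpos := (E.weight_pos k).trans_le hlarge
    have hone : 1 ≤ (U i - U j + κ * (U (k + 1) - U j)) * ‖E.single k‖ := by
      rw [← E.weight_mul_norm_single k]
      gcongr
    simp only [x]
    rw [hT.apply_smul_single, radialRetraction_smul hpos hone, smul_smul, ← add_smul]
    congr 1
    change _ + κ * E.weight k = _
    linear_combination -κ * hU k
  have hconst : ∀ k, i ≤ k → k ≤ j →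
      E.coord (x k + φ (x k)) k = E.coord (x i + φ (x i)) i := by
    intro k hik
    induction k, hik using Int.leInduction with
    | base => exact fun _ => rfl
    | succ k hik ih =>
      intro hkj
      rw [← ih (by omega), ← hT, hconj, hx hik hkj]
  have hends := congrArg Complex.re (hconst j hij le_rfl)
  simp only [x, map_add, Pi.add_apply, E.coord_smul_single, Complex.add_re,
    Complex.ofReal_re] at hends
  have hre (k : ℤ) : |(E.coord (φ (x k)) k).re| ≤ E.weight k := by
    simpa using (Complex.abs_re_le_norm _).trans (E.norm_coord_le_of_le (hφ (x k)) k)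
  linarith [abs_le.1 (hre i), abs_le.1 (hre j)]

theorem exists_isDominatedPrimitive_of_stronglyStructurallyStable (hT : E.IsBackwardShift T)
    (hstable : StronglyStructurallyStable (T : X →L[ℂ] X)) :
    ∃ s K, IsDominatedPrimitive E.weight s K := by
  obtain ⟨U, hU⟩ := exists_forall_eq_succ_add E.weight
  obtain ⟨δ, hδ, hstable⟩ := hstable 1 one_pos
  obtain ⟨κ, hκ, hκδ⟩ := exists_pos_mul_lt hδ (1 + 2 * ‖(T : X →L[ℂ] X)‖)
  have hκT : 0 ≤ ‖(T : X →L[ℂ] X)‖ * κ := by positivity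
  obtain ⟨φ, hφ, -, hconj⟩ := hstable (fun x => κ • radialRetraction (T x))
    (fun x => by
      rw [norm_smul, Real.norm_of_nonneg hκ.le]
      linarith [mul_le_of_le_one_right hκ.le (norm_radialRetraction_le_one (T x))])
    (fun x y => by
      calc ‖κ • radialRetraction (T x) - κ • radialRetraction (T y)‖
          ≤ κ * (2 * (‖(T : X →L[ℂ] X)‖ * ‖x - y‖)) := by
            rw [← smul_sub, norm_smul, Real.norm_of_nonneg hκ.le]
            gcongr
            refine (norm_radialRetraction_sub_le _ _).trans ?_
            rw [← map_sub]
            gcongr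
            exact (T : X →L[ℂ] X).le_opNorm _
        _ = 2 * ‖(T : X →L[ℂ] X)‖ * κ * ‖x - y‖ := by ring
        _ ≤ δ * ‖x - y‖ := by
            gcongr
            linarith)
  have hle {i j : ℤ} (hij : i ≤ j) : κ * (U i - U j) ≤ E.weight i + E.weight j :=
    hT.mul_sub_le_of_conjugacy hU hκ hφ hconj hij
  obtain ⟨a, ha⟩ := exists_forall_abs_sub_le (u := fun k => κ * U k) (r := E.weight) fun i j => by
    rcases le_total i j with hij | hji
    · linarith [hle hij]
    · have := antitone_of_eq_succ_add hU (fun k => (E.weight_pos k).le) hji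
      nlinarith [E.weight_pos i, E.weight_pos j]
  refine ⟨_, κ⁻¹, .sub_const hU (a := κ⁻¹ * a) fun k => ?_⟩
  rw [le_inv_mul_iff₀ hκ, ← abs_of_pos hκ, ← abs_mul, abs_of_pos hκ, mul_sub,
    mul_inv_cancel_left₀ hκ.ne']
  exact ha k

theorem norm_zpow_comp_le_of_weight_le (hT : E.IsBackwardShift T) {P : X →L[ℂ] X} {A : Set ℤ}
    (hP : ∀ x, E.coord (P x) = A.indicator (E.coord x)) {C : ℝ} (hC : 0 ≤ C) {m : ℤ}
    (hA : ∀ k ∈ A, E.weight k ≤ C * E.weight (k - m)) :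
    ‖((T ^ m : X ≃L[ℂ] X) : X →L[ℂ] X) ∘L P‖ ≤ C := by
  refine ContinuousLinearMap.opNorm_le_bound _ hC fun x => ?_
  obtain ⟨y, hy, hyx⟩ := E.exists_norm_le_of_dominated ((C : ℂ) • x)
    (E.coord ((T ^ m) (P x))) m fun k => by
      rw [hT.coord_zpow_apply, hP, map_smul, Pi.smul_apply, norm_smul, Complex.norm_real,
        Real.norm_of_nonneg hC, mul_right_comm]
      by_cases hk : k + m ∈ A
      · rw [Set.indicator_of_mem hk, mul_comm]
        gcongr
        calc ‖E.single k‖ = E.weight (k + m) * ‖E.single (k + m)‖ * ‖E.single k‖ := by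
              rw [E.weight_mul_norm_single, one_mul]
          _ ≤ C * E.weight k * ‖E.single (k + m)‖ * ‖E.single k‖ := by
              gcongr
              simpa only [add_sub_cancel_right] using hA _ hk
          _ = C * ‖E.single (k + m)‖ := by
              linear_combination C * ‖E.single (k + m)‖ * E.weight_mul_norm_single k
      · rw [Set.indicator_of_notMem hk, norm_zero, zero_mul]
        positivity
  rw [E.coord_injective hy] at hyx
  rwa [norm_smul, Complex.norm_real, Real.norm_of_nonneg hC] at hyx

theorem exists_isGreenKernel (hT : E.IsBackwardShift T) {s : ℤ → ℝ} {K : ℝ}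
    (hs : IsDominatedPrimitive E.weight s K) : ∃ Γ, IsGreenKernel (T : X →L[ℂ] X) Γ := by
  obtain ⟨P, hP⟩ := E.exists_coord_eq_indicator {k | 0 ≤ s k + s (k + 1)}
  have hP' (x : X) : E.coord ((1 - P) x) =
      {k | 0 ≤ s k + s (k + 1)}ᶜ.indicator (E.coord x) := by
    rw [Set.indicator_compl, ← hP, ← map_sub]
    rfl
  have hgeom := hs.summable_geom E.weight_pos
  have hK := hs.nonneg E.weight_pos
  refine ⟨_, isGreenKernel_dichotomyKernel (P := P)
    (.of_nonneg_of_le (fun m => norm_nonneg _) (fun m => ?_) hgeom)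
    (.of_nonneg_of_le (fun m => norm_nonneg _) (fun m => ?_) hgeom)⟩
  · exact hT.norm_zpow_comp_le_of_weight_le hP (by positivity)
      fun k hk => hs.le_geom_sub E.weight_pos hk m
  · refine hT.norm_zpow_comp_le_of_weight_le hP' (by positivity) fun k hk => ?_
    rw [show k - (-(m : ℤ) - 1) = k + 1 + m by ring]
    exact hs.le_geom_add E.weight_pos (le_of_not_ge hk) m

theorem stronglyStructurallyStable_iff_hasShadowing [CompleteSpace X]
    (hT : E.IsBackwardShift T) :
    StronglyStructurallyStable (T : X →L[ℂ] X) ↔ HasShadowing T := by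
  constructor
  · intro hstable
    obtain ⟨s, K, hs⟩ := hT.exists_isDominatedPrimitive_of_stronglyStructurallyStable hstable
    obtain ⟨Γ, hΓ⟩ := hT.exists_isGreenKernel hs
    exact hΓ.hasShadowing
  · intro hshadow
    obtain ⟨s, K, hs⟩ := hT.exists_isDominatedPrimitive_of_hasShadowing hshadow
    obtain ⟨Γ, hΓ⟩ := hT.exists_isGreenKernel hs
    exact hΓ.stronglyStructurallyStable

end IsBackwardShift

end SequenceSpace

end SequenceSpaces

section LpAndZeroAtInfty

theorem exists_lp_comp_equiv {ι κ V : Type*} [NormedAddCommGroup V] {p : ℝ≥0∞} (hp : p ≠ 0)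
    (x : lp (fun _ : ι => V) p) (e : κ ≃ ι) :
    ∃ y : lp (fun _ : κ => V) p, (∀ k, y k = x (e k)) ∧ ‖y‖ = ‖x‖ := by
  rcases p.trichotomy with rfl | rfl | hp
  · exact absurd rfl hp
  · have hrange : Set.range (fun k => ‖x (e k)‖) = Set.range fun i => ‖x i‖ :=
      e.surjective.range_comp fun i => ‖x i‖
    refine ⟨⟨fun k => x (e k), memℓp_infty ?_⟩, fun _ => rfl, ?_⟩
    · rw [hrange]
      exact memℓp_infty_iff.1 (lp.memℓp x)
    · exact e.surjective.iSup_comp fun i => ‖x i‖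
  · refine ⟨⟨fun k => x (e k), memℓp_gen ?_⟩, fun _ => rfl, ?_⟩
    · exact e.summable_iff.2 ((lp.memℓp x).summable hp)
    · rw [lp.norm_eq_tsum_rpow hp, lp.norm_eq_tsum_rpow hp,
        ← e.tsum_eq fun i => ‖x i‖ ^ p.toReal]

/-- `ℓ_p(ℤ)` as a sequence space. -/
noncomputable def lpSequenceSpace (p : ℝ≥0∞) [Fact (1 ≤ p)] :
    SequenceSpace (lp (fun _ : ℤ => ℂ) p) where
  coord := { toFun x := x, map_add' _ _ := rfl, map_smul' _ _ := rfl }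
  coord_injective _ _ h := lp.ext h
  single k := lp.single p k 1
  coord_single k := lp.coeFn_single p k 1
  exists_norm_le_of_dominated x u m h := by
    have hp : 0 < p := zero_lt_one.trans_le Fact.out
    obtain ⟨y, hy, hyx⟩ := exists_lp_comp_equiv hp.ne' x (Equiv.addRight m)
    have huy (k : ℤ) : ‖u k‖ ≤ ‖y k‖ := by
      have hk := h k
      simp only [lp.norm_single hp, norm_one, mul_one] at hk
      rw [hy]
      exact hk
    refine ⟨⟨u, (lp.memℓp y).mono' huy⟩, rfl, ?_⟩
    exact (lp.norm_mono hp.ne' huy).trans_eq hyx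

/-- The unit vectors of `c_0(ℤ)`. -/
noncomputable def zeroAtInftySingle (k : ℤ) : ZeroAtInftyContinuousMap ℤ ℂ where
  toFun := Pi.single k 1
  continuous_toFun := continuous_of_discreteTopology
  zero_at_infty' := by
    rw [Filter.cocompact_eq_cofinite]
    refine tendsto_const_nhds.congr' ?_
    filter_upwards [(Set.finite_singleton k).compl_mem_cofinite] with j hj
    rw [Pi.single_eq_of_ne hj]

theorem norm_zeroAtInfty_le {x : ZeroAtInftyContinuousMap ℤ ℂ} {C : ℝ} (hC : 0 ≤ C) :
    ‖x‖ ≤ C ↔ ∀ k, ‖x k‖ ≤ C := by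
  rw [← ZeroAtInftyContinuousMap.norm_toBCF_eq_norm]
  exact BoundedContinuousFunction.norm_le hC

theorem norm_zeroAtInfty_apply_le (x : ZeroAtInftyContinuousMap ℤ ℂ) (k : ℤ) : ‖x k‖ ≤ ‖x‖ :=
  (norm_zeroAtInfty_le (norm_nonneg x)).1 le_rfl k

theorem norm_zeroAtInftySingle (k : ℤ) : ‖zeroAtInftySingle k‖ = 1 := by
  refine le_antisymm ((norm_zeroAtInfty_le zero_le_one).2 fun j => ?_) ?_
  · change ‖(Pi.single k 1 : ℤ → ℂ) j‖ ≤ 1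
    rw [Pi.single_apply]
    split_ifs <;> simp
  · have hself : zeroAtInftySingle k k = 1 := Pi.single_eq_same (M := fun _ => ℂ) k 1
    rw [← norm_one (α := ℂ), ← hself]
    exact norm_zeroAtInfty_apply_le _ k

/-- `c_0(ℤ)` as a sequence space. -/
noncomputable def zeroAtInftySequenceSpace : SequenceSpace (ZeroAtInftyContinuousMap ℤ ℂ) where
  coord := { toFun x := x, map_add' _ _ := rfl, map_smul' _ _ := rfl }
  coord_injective := DFunLike.coe_injective
  single := zeroAtInftySingle
  coord_single _ := rfl
  exists_norm_le_of_dominated x u m h := by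
    have hux (k : ℤ) : ‖u k‖ ≤ ‖x (k + m)‖ := by
      simpa [norm_zeroAtInftySingle] using h k
    have hlim : Filter.Tendsto (fun k => x (k + m)) (Filter.cocompact ℤ) (nhds 0) :=
      x.zero_at_infty'.comp (Homeomorph.addRight m).isClosedEmbedding.tendsto_cocompact
    refine ⟨⟨⟨u, continuous_of_discreteTopology⟩,
      squeeze_zero_norm hux (norm_zero (E := ℂ) ▸ hlim.norm)⟩, rfl, ?_⟩
    exact (norm_zeroAtInfty_le (norm_nonneg _)).2 fun k =>
      (hux k).trans (norm_zeroAtInfty_apply_le x (k + m))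

end LpAndZeroAtInfty

theorem mainTheorem2_general {X : Type*} [NormedAddCommGroup X] [NormedSpace ℂ X] [CompleteSpace X]
    (E : SequenceSpace X) {w : ℤ → ℝ} {T : X ≃L[ℂ] X}
    (hT : ∀ x, E.coord (T x) = bilateralShift w (E.coord x)) :
    StronglyStructurallyStable (T : X →L[ℂ] X) ↔ HasShadowing T := by
  obtain ⟨v, hv⟩ := E.exists_isBackwardShift_reweight hT
  exact hv.stronglyStructurallyStable_iff_hasShadowing

theorem mainTheorem2 (w : ℤ → ℝ) (hw : ∀ n, 0 < w n) :
    (∀ (p : ℝ≥0∞) [Fact (1 ≤ p)], p ≠ ∞ →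
      ∀ T : lp (fun _ : ℤ => ℂ) p ≃L[ℂ] lp (fun _ : ℤ => ℂ) p,
        (∀ x : lp (fun _ : ℤ => ℂ) p, (T x : ℤ → ℂ) = bilateralShift w (x : ℤ → ℂ)) →
          (StronglyStructurallyStable
              (T : lp (fun _ : ℤ => ℂ) p →L[ℂ] lp (fun _ : ℤ => ℂ) p) ↔
            HasShadowing T)) ∧
    (∀ T : ZeroAtInftyContinuousMap ℤ ℂ ≃L[ℂ] ZeroAtInftyContinuousMap ℤ ℂ,
        (∀ x : ZeroAtInftyContinuousMap ℤ ℂ, (T x : ℤ → ℂ) = bilateralShift w (x : ℤ → ℂ)) →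
          (StronglyStructurallyStable
              (T : ZeroAtInftyContinuousMap ℤ ℂ →L[ℂ] ZeroAtInftyContinuousMap ℤ ℂ) ↔
            HasShadowing T)) :=
  ⟨fun p _ _ _ hT => mainTheorem2_general (lpSequenceSpace p) hT,
    fun _ hT => mainTheorem2_general zeroAtInftySequenceSpace hT⟩
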